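/- Let $(X,\mathcal B)$ be a measurable space with countably generated $\sigma$-algebra, and let $m^i=(m^i_x)_{x\in X}$, $i=1,2$, be random walks on it, i.e. families of probability measures on $\mathcal B$ such that $x\mapsto m^i_x(B)$ is measurable for every $B\in\mathcal B$. Let $\nu_1$ be a measure with $\nu_1(X)<\infty$ that is invariant for $m^1$, i.e. $\int_X m^1_x(B)\,d\nu_1(x)=\nu_1(B)$ for all $B\in\mathcal B$, and let $\nu_2$ be a $\sigma$-finite measure that is reversible for $m^2$, i.e. $dm^2_x(y)\,d\nu_2(x)=dm^2_y(x)\,d\nu_2(y)$. Assume $\nu_2\ll\nu_1$, $\mu:=\frac{d\nu_2}{d\nu_1}\in L^\infty(X,\nu_1)$, and $\mu\ge c$ $\nu_1$-a.e. for some $c>0$. Let $p>1$. For measurable $u:X\to\mathbb R$ put $$\mathcal F_{1,m^1}(u)=\frac12\int_X\int_X|u(y)-u(x)|\,dm^1_x(y)\,d\nu_1(x)\in[0,\infty],$$ and assume that $\mathcal F_{1,m^1}$ satisfies a $1$-Poincaré inequality: there is $\lambda_1>0$ with $\lambda_1\|u\|_{L^1(X,\nu_1)}\le\mathcal F_{1,m^1}(u)$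 for all $u\in L^1(X,\nu_1)$ with $\int_X u\,d\nu_1=0$. Let $\Delta_1^{m^1}$ be the multivalued operator in $L^2(X,\nu_1)$ given by $v\in\Delta_1^{m^1}u$ iff $-v$ belongs to the subdifferential at $u$ of $\mathcal F_{1,m^1}$ on $L^2(X,\nu_1)$. Let $v=\Delta_p^{m^2}u$ mean that $u,v\in L^2(X,\nu_2)$, $\int_X\int_X|u(y)-u(x)|^p\,dm^2_x(y)\,d\nu_2(x)<\infty$, and $v(x)=\int_X|u(y)-u(x)|^{p-2}(u(y)-u(x))\,dm^2_x(y)$ for $\nu_2$-a.e. $x$. Let $u_0\in L^2(X,\nu_1)$, $T>0$, and let $u$ be the strong solution on $[0,T]$ of $$u_t-\Delta_1^{m^1}u-\mu\,\Delta_p^{m^2}u\ni0,\qquad u(0)=u_0,$$ i.e. $u\in C([0,T];L^2(X,\nu_1))\cap W^{1,2}_{\rm loc}(0,T;L^2(X,\nu_1))$, $u(0)=u_0$, and the inclusion holds in $L^2(X,\nu_1)$ for almost every $t\in(0,T)$. Then, with $\overline{u_0}=\frac1{\nu_1(X)}\int_Xu_0\,d\nu_1$, $$\|u(t)-\overline{u_0}\|_{L^1(X,\nu_1)}\le\frac1{2\lambda_1}\,\frac{\|u_0\|_{L^2(X,\nu_1)}^2}{t}\qquad\text{for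 all }0<t\le T.$$ As $T>0$ is arbitrary, a solution on $[0,\infty)$ satisfies this bound for all $t>0$. -/

import Mathlib

open MeasureTheory ProbabilityTheory Set
open scoped ENNReal

noncomputable section

namespace RandomWalk

/-- The subdifferential of a functional `F : H → (-∞, +∞]` on a real Hilbert space, as a
multivalued operator (its graph): `v ∈ ∂F(u)` iff `u` lies in the domain of `F` and
`F(w) - F(u) ≥ (v, w - u)` for all `w`. -/
def subdifferential {H : Type*} [NormedAddCommGroup H] [InnerProductSpace ℝ H]
    (F : H → EReal) : Set (H × H) :=
  {z | F z.1 ≠ ⊤ ∧ ∀ w : H, F z.1 + ((inner ℝ z.2 (w - z.1) : ℝ) : EReal) ≤ F w}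

/-- `u` is a strong solution on `[0, T]` of `du/dt + A u ∋ 0`, `u(0) = u₀`, for a multivalued
operator with graph `A ⊆ H × H`: `u ∈ C([0,T]; H)`, `u ∈ W^{1,2}_loc(0,T; H)` with derivative `g`
(that is, `g ∈ L²_loc(0,T; H)` and `u` is a primitive of `g` on `(0,T)`), and for almost all
`t ∈ (0,T)` there is `w ∈ A(u(t))` with `u'(t) + w = 0`. -/
structure IsStrongSolution {H : Type*} [NormedAddCommGroup H] [InnerProductSpace ℝ H]
    (A : Set (H × H)) (T : ℝ) (u₀ : H) (u : ℝ → H) : Prop where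
  continuousOn : ContinuousOn u (Icc 0 T)
  initial : u 0 = u₀
  equation : ∃ g : ℝ → H,
    (∀ a b : ℝ, 0 < a → a < b → b < T →
      MemLp g 2 (volume.restrict (Icc a b)) ∧ u b - u a = ∫ s in a..b, g s) ∧
    ∀ᵐ t ∂(volume.restrict (Ioo 0 T)), ∃ w : H, (u t, w) ∈ A ∧ g t + w = 0

variable {X : Type*} [MeasurableSpace X]

/-- The total variation functional
`F_{1,m}(u) = (1/2) ∫_{X × X} |u(y) - u(x)| d(ν ⊗ m_x)(x,y)`, equal to `+∞` when the integral
diverges, i.e. when `u` is not of bounded variation. -/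
def totalVariation (m : Kernel X X) (ν : Measure X) (u : X → ℝ) : ℝ≥0∞ :=
  (1 / 2) * ∫⁻ z : X × X, ENNReal.ofReal |u z.2 - u z.1| ∂(ν ⊗ₘ m)

/-- `F_{1,m}` satisfies the `r`-Poincaré inequality with constant `lam`:
`lam ‖u‖_{L^r(X,ν)} ≤ F_{1,m}(u)` for all `u ∈ L^r(X,ν)` with `∫ u dν = 0`
(for `u = 0` this is trivially true). -/
def PoincareInequality (r : ℝ≥0∞) (m : Kernel X X) (ν : Measure X) (lam : ℝ) : Prop :=
  ∀ u : X → ℝ, MemLp u r ν → ∫ x, u x ∂ν = 0 →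
    ENNReal.ofReal lam * eLpNorm u r ν ≤ totalVariation m ν u

/-- The `m`-1-Laplacian as a multivalued operator in `L²(X,ν)`:
`(u, v) ∈ Δ₁^m` iff `(u, -v) ∈ ∂ F_{1,m}`. -/
def oneLaplacian (m : Kernel X X) (ν : Measure X) : Set (Lp ℝ 2 ν × Lp ℝ 2 ν) :=
  {z | (z.1, -z.2) ∈
    subdifferential (fun u : Lp ℝ 2 ν => ((totalVariation m ν u : ℝ≥0∞) : EReal))}

/-- `(u, v) ∈ Δ_p^m`: `u, v ∈ L²(X,ν)`, `∇u ∈ L^p(X × X, ν ⊗ m_x)` and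
`v(x) = ∫ |u(y) - u(x)|^{p-2} (u(y) - u(x)) dm_x(y)` for `ν`-a.e. `x`. -/
def IsPLaplacian (p : ℝ) (m : Kernel X X) (ν : Measure X) (u v : X → ℝ) : Prop :=
  MemLp u 2 ν ∧ MemLp v 2 ν ∧
  MemLp (fun z : X × X => u z.2 - u z.1) (ENNReal.ofReal p) (ν ⊗ₘ m) ∧
  ∀ᵐ x ∂ν, v x = ∫ y, |u y - u x| ^ (p - 2) * (u y - u x) ∂(m x)

/-- The density `μ = dν₂/dν₁` as a real function. -/
def density (ν₁ ν₂ : Measure X) (x : X) : ℝ := (ν₂.rnDeriv ν₁ x).toReal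

/-- The multivalued operator `-Δ₁^{m¹} - μ Δ_p^{m²}` in `L²(X,ν₁)`, where `μ = dν₂/dν₁`. -/
def onePOperator (p : ℝ) (m₁ m₂ : Kernel X X) (ν₁ ν₂ : Measure X) :
    Set (Lp ℝ 2 ν₁ × Lp ℝ 2 ν₁) :=
  {z | ∃ (v₁ : Lp ℝ 2 ν₁) (v₂ : X → ℝ),
    (z.1, v₁) ∈ oneLaplacian m₁ ν₁ ∧ IsPLaplacian p m₂ ν₂ z.1 v₂ ∧
    ∀ᵐ x ∂ν₁, z.2 x = -v₁ x - density ν₁ ν₂ x * v₂ x}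

end RandomWalk

end

/-!
Write `A = -Δ₁ - μ Δ_p`, `c` for the mean of `u₀`, `F` for the total variation functional of `m₁`,
and `N(t) = ‖u(t) - c‖_{L¹}`. The proof is an energy estimate for `u' + A u ∋ 0`.

* For `w ∈ A x` and `q : ℝ → ℝ` monotone, bounded and Lipschitz, `∫ w q(x) dν₁ ≥ 0`
  (`onePOperator_integral_mul_nonneg`). The `1`-Laplacian part is the subgradient inequality
  tested with `x - ε q(x)`: for small `ε` this is a nondecreasing `1`-Lipschitz function of `x`, so
  its total variation is at most that of `x`. In the `p`-Laplacian part the weight `μ` turns `ν₁`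
  into `ν₂`, and reversibility gives the integration by parts
  `∫ Δ_p u · q(u) dν₂ = -½ ∫∫ |∇u|^{p-2} ∇u ∇(q ∘ u) ≤ 0`.
* Constant `q` shows that the mean of `u(t)` is conserved (`integral_strongSolution_eq`). A
  regularized sign for `q` shows that `N` is nonincreasing (`integral_abs_sub_strongSolution_le`).
* Testing with `0` instead, `F(x) ≤ ⟨w, x⟩` (`totalVariation_le_inner_onePOperator`). With the
  Poincaré inequality, `λ N(s) ≤ F(u(s)) ≤ -⟨u'(s), u(s)⟩` for almost every `s`.

Integrating the last inequality over `(0, t)` and using `N(t) ≤ N(s)` gives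
`λ t N(t) ≤ ½ ‖u₀‖² - ½ ‖u(t)‖²`, which is the claim.

All three dissipation statements go through `IsStrongSolution.energy_le`, a one-sided chain rule for
convex `φ` with a continuous selection `Q` of the subdifferential. It needs only the subgradient
inequality, not the almost everywhere differentiability of `u`.
-/

namespace RandomWalk

/-! ### Convex energies along strong solutions in a Hilbert space -/

section Evolution

variable {H : Type*} [NormedAddCommGroup H] [InnerProductSpace ℝ H]

/-- A function that does not increase over steps of length at most `δ`, uniformly on `[a, b]`, does not
increase over `[a, b]`. -/
lemma le_of_locally_antitone {h : ℝ → ℝ} {a b δ : ℝ} (hδ : 0 < δ)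
    (hh : ∀ s ∈ Icc a b, ∀ t ∈ Icc a b, s ≤ t → t - s ≤ δ → h t ≤ h s) (hab : a ≤ b) :
    h b ≤ h a := by
  have key : ∀ n : ℕ, ∀ t ∈ Icc a b, t - a ≤ n * δ → h t ≤ h a := by
    intro n
    induction n with
    | zero =>
      intro t ht hta
      have : t = a := le_antisymm (by simpa using hta) ht.1
      rw [this]
    | succ n ih =>
      intro t ht hta
      push_cast at hta
      have hs : max a (t - δ) ∈ Icc a b :=
        ⟨le_max_left _ _, max_le hab (by linarith [ht.2])⟩
      refine (hh _ hs t ht (max_le ht.1 (by linarith)) ?_).trans (ih _ hs ?_)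
      · linarith [le_max_right a (t - δ)]
      · rcases max_cases a (t - δ) with h | h
        · rw [h.1]; simp; positivity
        · rw [h.1]; linarith
  obtain ⟨n, hn⟩ := exists_nat_ge ((b - a) / δ)
  exact key n b ⟨hab, le_rfl⟩ (by rwa [div_le_iff₀ hδ] at hn)

lemma integrableOn_inner_of_continuousOn {f g : ℝ → H} {a b : ℝ} (hf : ContinuousOn f (Icc a b))
    (hg : IntegrableOn g (Icc a b)) :
    IntegrableOn (fun s => inner ℝ (f s) (g s) : ℝ → ℝ) (Icc a b) := by
  obtain ⟨C, hC⟩ := isCompact_Icc.exists_bound_of_continuousOn hf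
  refine Integrable.mono' (hg.norm.const_mul C)
    ((hf.aestronglyMeasurable measurableSet_Icc).inner hg.aestronglyMeasurable) ?_
  filter_upwards [ae_restrict_mem measurableSet_Icc] with s hs
  exact (norm_inner_le_norm _ _).trans (mul_le_mul_of_nonneg_right (hC s hs) (norm_nonneg _))

lemma continuous_of_subgradient {φ : H → ℝ} {Q : H → H} (hQ : Continuous Q)
    (hφ : ∀ x y, φ x - φ y ≤ inner ℝ (Q x) (x - y)) : Continuous φ := by
  refine continuous_iff_continuousAt.2 fun y => ?_
  have hl : Continuous fun x => φ y + inner ℝ (Q y) (x - y) := by fun_prop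
  have hr : Continuous fun x => φ y + inner ℝ (Q x) (x - y) := by fun_prop
  refine tendsto_of_tendsto_of_tendsto_of_le_of_le (by simpa using hl.tendsto y)
    (by simpa using hr.tendsto y) (fun x => ?_) fun x => ?_
  · have := hφ y x
    rw [← neg_sub x y, inner_neg_right] at this
    simp only
    linarith
  · have := hφ x y
    simp only
    linarith

variable [CompleteSpace H]

/-- One-sided chain rule along the primitive `u` of `g`: if `Q` is a continuous selection of the
subdifferential of `φ`, then `φ(u)` grows at most by the integral of `⟨Q(u), g⟩`. On a short interval
`[s, t]` the subgradient inequality at `u t` gives the bound with `Q(u t)` in place of `Q(u r)`, and the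
uniform continuity of `Q ∘ u` controls the difference. -/
lemma energy_sub_le_integral_inner {φ : H → ℝ} {Q : H → H} (hQ : Continuous Q)
    (hφ : ∀ x y, φ x - φ y ≤ inner ℝ (Q x) (x - y)) {u g : ℝ → H} {a b : ℝ} (hab : a ≤ b)
    (hu : ContinuousOn u (Icc a b)) (hg : IntegrableOn g (Icc a b))
    (hug : ∀ s ∈ Icc a b, ∀ t ∈ Icc a b, s ≤ t → u t - u s = ∫ r in s..t, g r) :
    φ (u b) - φ (u a) ≤ ∫ s in a..b, inner ℝ (Q (u s)) (g s) := by
  have hQu : ContinuousOn (fun s => Q (u s)) (Icc a b) := hQ.comp_continuousOn hu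
  have hprod : IntegrableOn (fun s => inner ℝ (Q (u s)) (g s) : ℝ → ℝ) (Icc a b) :=
    integrableOn_inner_of_continuousOn hQu hg
  have sub_int : ∀ {f : ℝ → ℝ}, IntegrableOn f (Icc a b) → ∀ s ∈ Icc a b, ∀ t ∈ Icc a b, s ≤ t →
      IntervalIntegrable f volume s t := by
    intro f hf s hs t ht hst
    rw [intervalIntegrable_iff_integrableOn_Icc_of_le hst]
    exact hf.mono_set (Icc_subset_Icc hs.1 ht.2)
  have ha : a ∈ Icc a b := ⟨le_rfl, hab⟩
  have hb : b ∈ Icc a b := ⟨hab, le_rfl⟩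
  set G : ℝ := ∫ s in a..b, ‖g s‖ with hG
  have hG0 : 0 ≤ G := intervalIntegral.integral_nonneg hab fun _ _ => norm_nonneg _
  -- The error of freezing `Q (u s)` on a short interval is a small multiple of `∫ ‖g‖`.
  have main : ∀ ε > 0, φ (u b) - φ (u a) ≤ (∫ s in a..b, inner ℝ (Q (u s)) (g s)) + ε * G := by
    intro ε hε
    obtain ⟨δ, hδ, hQδ⟩ := Metric.uniformContinuousOn_iff_le.1
      (isCompact_Icc.uniformContinuousOn_of_continuous hQu) ε hε
    have hmono := le_of_locally_antitone
      (h := fun t => φ (u t) - (∫ s in a..t, inner ℝ (Q (u s)) (g s))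
        - ε * ∫ s in a..t, ‖g s‖) (a := a) (b := b) hδ ?_ hab
    · simp only [intervalIntegral.integral_same] at hmono
      linarith
    · intro s hs t ht hst hts
      have i1 := sub_int hprod a ha s hs hs.1
      have i2 := sub_int hprod s hs t ht hst
      have j1 := sub_int hg.norm a ha s hs hs.1
      have j2 := sub_int hg.norm s hs t ht hst
      have k2 : IntervalIntegrable g volume s t :=
        (intervalIntegrable_iff_integrableOn_Icc_of_le hst).2
          (hg.mono_set (Icc_subset_Icc hs.1 ht.2))
      rw [← intervalIntegral.integral_add_adjacent_intervals i1 i2,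
        ← intervalIntegral.integral_add_adjacent_intervals j1 j2]
      have h1 := hφ (u t) (u s)
      have h2 : (inner ℝ (Q (u t)) (u t - u s) : ℝ) = ∫ r in s..t, inner ℝ (Q (u t)) (g r) := by
        rw [hug s hs t ht hst]
        exact ((innerSL ℝ (Q (u t))).intervalIntegral_comp_comm k2).symm
      have h3 : (∫ r in s..t, inner ℝ (Q (u t)) (g r) : ℝ)
          ≤ ∫ r in s..t, (inner ℝ (Q (u r)) (g r) + ε * ‖g r‖) := by
        refine intervalIntegral.integral_mono_on hst ?_ (i2.add (j2.const_mul ε)) ?_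
        · rw [intervalIntegrable_iff] at k2 ⊢
          exact k2.const_inner _
        · intro r hr
          have hr' : r ∈ Icc a b := ⟨hs.1.trans hr.1, hr.2.trans ht.2⟩
          have htr : dist t r ≤ δ := by
            rw [Real.dist_eq, abs_of_nonneg (sub_nonneg.2 hr.2)]
            linarith [hr.1]
          have hd : ‖Q (u t) - Q (u r)‖ ≤ ε := by
            rw [← dist_eq_norm]
            exact hQδ t ht r hr' htr
          have h4 := (real_inner_le_norm (Q (u t) - Q (u r)) (g r)).trans
            (mul_le_mul_of_nonneg_right hd (norm_nonneg _))
          rw [inner_sub_left] at h4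
          linarith
      rw [intervalIntegral.integral_add i2 (j2.const_mul ε),
        intervalIntegral.integral_const_mul] at h3
      linarith
  refine le_of_forall_pos_le_add fun ε hε => ?_
  refine (main (ε / (G + 1)) (by positivity)).trans ?_
  gcongr
  rw [div_mul_eq_mul_div, div_le_iff₀ (by positivity)]
  nlinarith

/-- Energy dissipation for `u' + A u ∋ 0`, up to the endpoints `0` and `T`, where the equation gives
no information: there the bound is recovered by continuity. -/
lemma IsStrongSolution.energy_le {A : Set (H × H)} {T : ℝ} {u₀ : H} {u : ℝ → H}
    (hu : IsStrongSolution A T u₀ u) {φ : H → ℝ} {Q : H → H} (hQ : Continuous Q)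
    (hφ : ∀ x y, φ x - φ y ≤ inner ℝ (Q x) (x - y)) {a b B : ℝ} (ha : 0 ≤ a) (hab : a ≤ b)
    (hb : b ≤ T) (hB : ∀ t ∈ Ioo a b, ∀ w, (u t, w) ∈ A → B ≤ inner ℝ (Q (u t)) w) :
    φ (u b) + B * (b - a) ≤ φ (u a) := by
  rcases hab.eq_or_lt with rfl | hab
  · simp
  obtain ⟨g, hg, hgA⟩ := hu.equation
  have inside : ∀ s t, a < s → s < t → t < b → φ (u t) + B * (t - s) ≤ φ (u s) := by
    intro s t has hst htb
    have hsub : Icc s t ⊆ Icc 0 T := Icc_subset_Icc (by linarith) (by linarith)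
    have hgi : IntegrableOn g (Icc s t) :=
      (hg s t (by linarith) hst (by linarith)).1.integrable (by norm_num)
    have hle := energy_sub_le_integral_inner hQ hφ hst.le (hu.continuousOn.mono hsub) hgi
      (fun r hr r' hr' hrr => by
        rcases hrr.eq_or_lt with rfl | hrr
        · simp
        · exact (hg r r' (by linarith [hr.1]) hrr (by linarith [hr'.2])).2)
    have hQu : ContinuousOn (fun s => Q (u s)) (Icc s t) :=
      hQ.comp_continuousOn (hu.continuousOn.mono hsub)
    have hint : IntegrableOn (fun r => inner ℝ (Q (u r)) (g r) : ℝ → ℝ) (Icc s t) :=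
      integrableOn_inner_of_continuousOn hQu hgi
    have hupper : (∫ r in s..t, inner ℝ (Q (u r)) (g r) : ℝ) ≤ ∫ _ in s..t, -B := by
      refine intervalIntegral.integral_mono_ae_restrict hst.le
        ((intervalIntegrable_iff_integrableOn_Icc_of_le hst.le).2 hint) (by simp) ?_
      have h1 : ∀ᵐ r ∂(volume.restrict (Icc s t)), ∃ w : H, (u r, w) ∈ A ∧ g r + w = 0 :=
        ae_restrict_of_ae_restrict_of_subset
          (Icc_subset_Ioo (by linarith) (by linarith)) hgA
      filter_upwards [h1, ae_restrict_mem measurableSet_Icc] with r ⟨w, hw, hgw⟩ hr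
      have := hB r ⟨by linarith [hr.1], by linarith [hr.2]⟩ w hw
      rw [eq_neg_of_add_eq_zero_left hgw, inner_neg_right]
      linarith
    rw [intervalIntegral.integral_const, smul_eq_mul] at hupper
    linarith
  have hcont : ContinuousOn (fun s => φ (u s)) (Icc 0 T) :=
    (continuous_of_subgradient hQ hφ).comp_continuousOn hu.continuousOn
  -- Shrink `[a, b]` symmetrically to `[a + r, b - r]` and let `r → 0`.
  have hr0 : (0 : ℝ) ∈ Icc 0 ((b - a) / 2) := ⟨le_rfl, by linarith⟩
  have h1 : ContinuousOn (fun r : ℝ => φ (u (b - r)) + B * ((b - r) - (a + r)))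
      (Icc 0 ((b - a) / 2)) :=
    (hcont.comp (g := fun s => φ (u s)) (f := fun r : ℝ => b - r) (by fun_prop)
      fun r hr => ⟨by linarith [hr.1, hr.2], by linarith [hr.1]⟩).add (by fun_prop)
  have h2 : ContinuousOn (fun r : ℝ => φ (u (a + r))) (Icc 0 ((b - a) / 2)) :=
    hcont.comp (g := fun s => φ (u s)) (f := fun r : ℝ => a + r) (by fun_prop)
      fun r hr => ⟨by linarith [hr.1, hr.2], by linarith [hr.1, hr.2]⟩
  have hcl : (0 : ℝ) ∈ closure (Ioo 0 ((b - a) / 2)) := by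
    rw [closure_Ioo (by linarith)]
    exact hr0
  have := ContinuousWithinAt.closure_le hcl ((h1 0 hr0).mono Ioo_subset_Icc_self)
    ((h2 0 hr0).mono Ioo_subset_Icc_self)
    (fun r hr => inside (a + r) (b - r) (by linarith [hr.1]) (by linarith [hr.2])
      (by linarith [hr.1]))
  simpa using this

end Evolution

variable {X : Type*} [MeasurableSpace X]

/-! ### The total variation functional and the `1`-Laplacian -/

/-- Since `ν` is invariant, both marginals of `ν ⊗ₘ m` are `ν`, so the functional does not depend on
the representative of an a.e. class. -/
lemma totalVariation_congr_ae {m : Kernel X X} [IsMarkovKernel m] {ν : Measure X} [SFinite ν]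
    (hν : m.Invariant ν) {f g : X → ℝ} (hfg : f =ᵐ[ν] g) :
    totalVariation m ν f = totalVariation m ν g := by
  have h1 : ∀ᵐ z ∂(ν ⊗ₘ m), f z.1 = g z.1 := by
    refine ae_of_ae_map measurable_fst.aemeasurable (p := fun y => f y = g y) ?_
    change ∀ᵐ y ∂(ν ⊗ₘ m).fst, f y = g y
    rwa [Measure.fst_compProd]
  have h2 : ∀ᵐ z ∂(ν ⊗ₘ m), f z.2 = g z.2 := by
    refine ae_of_ae_map measurable_snd.aemeasurable (p := fun y => f y = g y) ?_
    change ∀ᵐ y ∂(ν ⊗ₘ m).snd, f y = g y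
    rw [Measure.snd_compProd, hν.def]
    exact hfg
  unfold totalVariation
  congr 1
  refine lintegral_congr_ae ?_
  filter_upwards [h1, h2] with z hz1 hz2
  rw [hz1, hz2]

lemma totalVariation_le_of_abs_sub_le {m : Kernel X X} {ν : Measure X} {f g : X → ℝ}
    (h : ∀ x y, |g y - g x| ≤ |f y - f x|) : totalVariation m ν g ≤ totalVariation m ν f := by
  unfold totalVariation
  gcongr 1 / 2 * ?_
  exact lintegral_mono fun z => ENNReal.ofReal_le_ofReal (h _ _)

/-- The Poincaré inequality for functions of arbitrary mean: constants do not contribute to `F`. -/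
lemma ofReal_mul_eLpNorm_sub_average_le_totalVariation {m : Kernel X X} {ν : Measure X}
    [IsFiniteMeasure ν] {lam : ℝ}
    (hP : PoincareInequality 1 m ν lam) (f : Lp ℝ 2 ν) :
    ENNReal.ofReal lam * eLpNorm (fun x => f x - ⨍ y, f y ∂ν) 1 ν
      ≤ totalVariation m ν f := by
  have hf : MemLp f 1 ν := (Lp.memLp f).mono_exponent one_le_two
  refine (hP _ (hf.sub (memLp_const _)) (integral_sub_average ν f)).trans ?_
  exact totalVariation_le_of_abs_sub_le fun x y => by simp

lemma inner_eq_integral_mul {ν : Measure X} (f g : Lp ℝ 2 ν) :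
    inner ℝ f g = ∫ x, g x * f x ∂ν := by
  simp [L2.inner_def]

/-- The subgradient inequality in real numbers, for competitors of no larger total variation. -/
lemma oneLaplacian_inner_le {m : Kernel X X} {ν : Measure X} {x v w : Lp ℝ 2 ν}
    (h : (x, v) ∈ oneLaplacian m ν) (hw : totalVariation m ν w ≤ totalVariation m ν x) :
    totalVariation m ν x ≠ ⊤ ∧
      (totalVariation m ν x).toReal + inner ℝ v (x - w) ≤ (totalVariation m ν w).toReal := by
  obtain ⟨h1, h2⟩ := h
  have hx : totalVariation m ν x ≠ ⊤ := fun h => h1 (by simp [h])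
  refine ⟨hx, ?_⟩
  have hw' : totalVariation m ν w ≠ ⊤ := ne_top_of_le_ne_top hx hw
  have h3 := h2 w
  simp only at h3
  rw [← ENNReal.ofReal_toReal hx, ← ENNReal.ofReal_toReal hw', EReal.coe_ennreal_ofReal,
    EReal.coe_ennreal_ofReal, max_eq_left ENNReal.toReal_nonneg,
    max_eq_left ENNReal.toReal_nonneg] at h3
  rw [← neg_sub w x, inner_neg_right, ← inner_neg_left]
  exact_mod_cast h3

/-- Test the subgradient inequality with `x - ε q(x)`, where `ε` is so small that `s ↦ s - ε q(s)` is
nondecreasing and `1`-Lipschitz. -/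
lemma oneLaplacian_integral_mul_nonpos {m : Kernel X X} [IsMarkovKernel m] {ν : Measure X}
    [IsFiniteMeasure ν] (hν : m.Invariant ν) {x v : Lp ℝ 2 ν} (h : (x, v) ∈ oneLaplacian m ν)
    {q : ℝ → ℝ} (hq : Monotone q) {K : NNReal} (hK : LipschitzWith K q)
    (hqx : MemLp (fun a => q (x a)) 2 ν) : ∫ a, v a * q (x a) ∂ν ≤ 0 := by
  -- `1 / (K + 1)` instead of `1 / K` also covers `K = 0`.
  set ε : ℝ := 1 / (K + 1) with hε
  have hε0 : 0 < ε := by positivity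
  have hεK : ε * K ≤ 1 := by
    rw [hε, one_div_mul_eq_div, div_le_one (by positivity)]
    linarith
  set f : Lp ℝ 2 ν := hqx.toLp _
  have hf : f =ᵐ[ν] fun a => q (x a) := hqx.coeFn_toLp
  have hcontr : ∀ s t : ℝ, |(t - ε * q t) - (s - ε * q s)| ≤ |t - s| := by
    have aux : ∀ s t : ℝ, s ≤ t → |(t - ε * q t) - (s - ε * q s)| ≤ |t - s| := by
      intro s t hst
      have h1 := hq hst
      have h2 := hK.dist_le_mul t s
      rw [Real.dist_eq, Real.dist_eq, abs_of_nonneg (sub_nonneg.2 h1),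
        abs_of_nonneg (sub_nonneg.2 hst)] at h2
      have h3 : ε * (q t - q s) ≤ ε * (K * (t - s)) := mul_le_mul_of_nonneg_left h2 hε0.le
      have h4 : ε * K * (t - s) ≤ 1 * (t - s) :=
        mul_le_mul_of_nonneg_right hεK (sub_nonneg.2 hst)
      have h5 : 0 ≤ ε * (q t - q s) := mul_nonneg hε0.le (sub_nonneg.2 h1)
      rw [abs_of_nonneg (sub_nonneg.2 hst), abs_le]
      constructor <;> linarith
    intro s t
    rcases le_total s t with hst | hst
    · exact aux s t hst
    · rw [abs_sub_comm, abs_sub_comm t s]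
      exact aux t s hst
  have hle : totalVariation m ν (x - ε • f : Lp ℝ 2 ν) ≤ totalVariation m ν x := by
    have : (x - ε • f : Lp ℝ 2 ν) =ᵐ[ν] fun a => x a - ε * q (x a) := by
      filter_upwards [Lp.coeFn_sub x (ε • f), Lp.coeFn_smul ε f, hf] with a h1 h2 h3
      rw [h1, Pi.sub_apply, h2, Pi.smul_apply, h3, smul_eq_mul]
    rw [totalVariation_congr_ae hν this]
    exact totalVariation_le_of_abs_sub_le fun y z => hcontr _ _
  obtain ⟨hx, hin⟩ := oneLaplacian_inner_le h hle
  have hmono := ENNReal.toReal_mono hx hle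
  rw [sub_sub_cancel, inner_smul_right] at hin
  have h6 : inner ℝ v f ≤ 0 := by
    by_contra! hpos
    have := mul_pos hε0 hpos
    linarith
  rw [real_inner_comm, inner_eq_integral_mul] at h6
  refine le_trans (le_of_eq (integral_congr_ae ?_)) h6
  filter_upwards [hf] with a ha
  rw [ha]

/-- Test the subgradient inequality with `0`. -/
lemma totalVariation_le_neg_inner {m : Kernel X X} [IsMarkovKernel m] {ν : Measure X}
    [IsFiniteMeasure ν] (hν : m.Invariant ν) {x v : Lp ℝ 2 ν} (h : (x, v) ∈ oneLaplacian m ν) :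
    totalVariation m ν x ≠ ⊤ ∧ (totalVariation m ν x).toReal ≤ -∫ a, v a * x a ∂ν := by
  have h0 : totalVariation m ν (0 : Lp ℝ 2 ν) = 0 := by
    rw [totalVariation_congr_ae hν (Lp.coeFn_zero ℝ 2 ν)]
    simp [totalVariation]
  obtain ⟨hx, hin⟩ := oneLaplacian_inner_le h (w := 0) (h0.le.trans zero_le)
  rw [h0, sub_zero, real_inner_comm, inner_eq_integral_mul, ENNReal.toReal_zero] at hin
  exact ⟨hx, by linarith⟩

/-! ### Integration by parts for the `p`-Laplacian -/

/-- Reversibility, stated on rectangles, as the symmetry of the measure `dm_x(y) dν(x)`. -/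
lemma compProd_map_swap {m : Kernel X X} [IsMarkovKernel m] {ν : Measure X} [IsFiniteMeasure ν]
    (h : m.IsReversible ν) : (ν ⊗ₘ m).map Prod.swap = ν ⊗ₘ m := by
  refine Measure.ext_prod fun {s t} hs ht => ?_
  rw [Measure.map_apply measurable_swap (hs.prod ht), Set.preimage_swap_prod,
    Measure.compProd_apply_prod ht hs, Measure.compProd_apply_prod hs ht, h hs ht]

/-- Integration by parts: the left side is `-½ ∫∫ |∇u|^{p-2} ∇u ∇(q ∘ u)`. Since `q` is bounded and
`ν` finite, all integrals converge: `|∇u|^{p-1} ≤ 1 + |∇u|^p`. -/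
lemma integral_pLaplacian_mul_monotone_nonpos {m : Kernel X X} [IsMarkovKernel m] {ν : Measure X}
    [IsFiniteMeasure ν] (hν : m.IsReversible ν) {p : ℝ} (hp : 1 < p) {u v : X → ℝ}
    (hu : Measurable u) (h : IsPLaplacian p m ν u v) {q : ℝ → ℝ} (hq : Monotone q) {C : ℝ}
    (hC : ∀ s, |q s| ≤ C) : ∫ x, v x * q (u x) ∂ν ≤ 0 := by
  obtain ⟨-, -, hgrad, hv⟩ := h
  set Φ : X × X → ℝ := fun z => |u z.2 - u z.1| ^ (p - 2) * (u z.2 - u z.1) with hΦ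
  have hΦm : Measurable Φ := by fun_prop
  have hp0 : (0 : ℝ) < p := by linarith
  have habs : ∀ z, ‖Φ z‖ ≤ 1 + |u z.2 - u z.1| ^ p := by
    intro z
    rw [hΦ, Real.norm_eq_abs, abs_mul, abs_of_nonneg (Real.rpow_nonneg (abs_nonneg _) _)]
    -- Where the gradient vanishes, `|0| ^ (p - 2) * 0 = 0` also for `p < 2`.
    rcases eq_or_ne (u z.2 - u z.1) 0 with h0 | h0
    · rw [h0]; simp [Real.zero_rpow hp0.ne']
    · have hpos : 0 < |u z.2 - u z.1| := abs_pos.2 h0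
      rw [← Real.rpow_add_one hpos.ne']
      rcases le_total |u z.2 - u z.1| 1 with h1 | h1
      · have := Real.rpow_le_one hpos.le h1 (z := p - 2 + 1) (by linarith)
        have := Real.rpow_nonneg hpos.le p
        linarith
      · have := Real.rpow_le_rpow_of_exponent_le h1 (show p - 2 + 1 ≤ p by linarith)
        linarith
  have hΦi : Integrable Φ (ν ⊗ₘ m) := by
    have h1 : Integrable (fun z : X × X => |u z.2 - u z.1| ^ p) (ν ⊗ₘ m) := by
      have := hgrad.integrable_norm_rpow (by simpa using hp0) ENNReal.ofReal_ne_top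
      simpa [ENNReal.toReal_ofReal hp0.le] using this
    exact ((integrable_const (1 : ℝ)).add h1).mono' hΦm.aestronglyMeasurable
      (Filter.Eventually.of_forall habs)
  have hqm : Measurable (fun x => q (u x)) := hq.measurable.comp hu
  have hi1 : Integrable (fun z => Φ z * q (u z.1)) (ν ⊗ₘ m) :=
    hΦi.mul_bdd (hqm.comp measurable_fst).aestronglyMeasurable
      (Filter.Eventually.of_forall fun z => hC _)
  have hi2 : Integrable (fun z => Φ z * q (u z.2)) (ν ⊗ₘ m) :=
    hΦi.mul_bdd (hqm.comp measurable_snd).aestronglyMeasurable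
      (Filter.Eventually.of_forall fun z => hC _)
  have e1 : ∫ x, v x * q (u x) ∂ν = ∫ z, Φ z * q (u z.1) ∂(ν ⊗ₘ m) := by
    rw [Measure.integral_compProd hi1]
    refine integral_congr_ae ?_
    filter_upwards [hv] with x hx
    rw [hx, integral_mul_const]
  have e2 : ∫ z, Φ z * q (u z.1) ∂(ν ⊗ₘ m) = - ∫ z, Φ z * q (u z.2) ∂(ν ⊗ₘ m) := by
    conv_lhs => rw [← compProd_map_swap hν]
    rw [integral_map measurable_swap.aemeasurable
      (f := fun z => Φ z * q (u z.1)) (hΦm.mul (hqm.comp measurable_fst)).aestronglyMeasurable,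
      ← integral_neg]
    congr 1 with z
    simp only [hΦ, Prod.fst_swap, Prod.snd_swap, abs_sub_comm (u z.1) (u z.2)]
    ring
  have e3 : 0 ≤ ∫ z, (Φ z * q (u z.2) - Φ z * q (u z.1)) ∂(ν ⊗ₘ m) := by
    refine integral_nonneg fun z => ?_
    have : 0 ≤ (u z.2 - u z.1) * (q (u z.2) - q (u z.1)) := by
      rcases le_total (u z.1) (u z.2) with h | h
      · exact mul_nonneg (sub_nonneg.2 h) (sub_nonneg.2 (hq h))
      · exact mul_nonneg_of_nonpos_of_nonpos (sub_nonpos.2 h) (sub_nonpos.2 (hq h))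
    calc (0 : ℝ) ≤ |u z.2 - u z.1| ^ (p - 2) * ((u z.2 - u z.1) * (q (u z.2) - q (u z.1))) :=
          mul_nonneg (Real.rpow_nonneg (abs_nonneg _) _) this
      _ = _ := by simp only [hΦ]; ring
  rw [integral_sub hi2 hi1] at e3
  linarith

/-- As `u` is not assumed to be in `L^p`, the integration by parts is applied to the truncations of
`u` at level `n`, and `n → ∞` by dominated convergence with the `L¹` bound `|v u|`. -/
lemma integral_pLaplacian_mul_self_nonpos {m : Kernel X X} [IsMarkovKernel m] {ν : Measure X}
    [IsFiniteMeasure ν] (hν : m.IsReversible ν) {p : ℝ} (hp : 1 < p) {u v : X → ℝ}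
    (hu : Measurable u) (h : IsPLaplacian p m ν u v) : ∫ x, v x * u x ∂ν ≤ 0 := by
  have hmono : ∀ n : ℕ, Monotone fun s : ℝ => max (-(n : ℝ)) (min (n : ℝ) s) := fun n _ _ hst =>
    max_le_max le_rfl (min_le_min le_rfl hst)
  have hself : ∀ (n : ℕ) (s : ℝ), |max (-(n : ℝ)) (min (n : ℝ) s)| ≤ |s| := by
    intro n s
    have hn : (0 : ℝ) ≤ n := n.cast_nonneg
    rw [abs_le]
    constructor
    · exact (le_min (by linarith [abs_nonneg s]) (neg_abs_le s)).trans (le_max_right _ _)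
    · exact max_le (by linarith [abs_nonneg s]) ((min_le_right _ _).trans (le_abs_self s))
  have hvu : Integrable (fun x => v x * u x) ν := h.2.1.integrable_mul h.1
  refine le_of_tendsto (tendsto_integral_of_dominated_convergence
    (F := fun (n : ℕ) x => v x * max (-(n : ℝ)) (min (n : ℝ) (u x))) _ (fun n => ?_) hvu.norm
    (fun n => ?_) ?_) (Filter.Eventually.of_forall fun n : ℕ =>
      integral_pLaplacian_mul_monotone_nonpos hν hp hu h (hmono n) (C := n) fun s => ?_)
  · exact h.2.1.aestronglyMeasurable.mul ((hmono n).measurable.comp hu).aestronglyMeasurable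
  · refine Filter.Eventually.of_forall fun x => ?_
    rw [norm_mul, norm_mul]
    exact mul_le_mul_of_nonneg_left (hself n (u x)) (norm_nonneg _)
  · refine Filter.Eventually.of_forall fun x => tendsto_const_nhds.congr' ?_
    obtain ⟨N, hN⟩ := exists_nat_ge |u x|
    filter_upwards [Filter.eventually_ge_atTop N] with n hn
    have hn' : |u x| ≤ n := hN.trans (by exact_mod_cast hn)
    rw [min_eq_right (abs_le.1 hn').2, max_eq_right (abs_le.1 hn').1]
  · have hn : (0 : ℝ) ≤ n := n.cast_nonneg
    exact abs_le.2 ⟨le_max_left _ _, max_le (by linarith) (min_le_left _ _)⟩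

/-! ### Dissipativity of `Δ₁ + μ Δ_p` -/

section Operator

variable {p : ℝ} {m₁ m₂ : Kernel X X} [IsMarkovKernel m₁] [IsMarkovKernel m₂]
  {ν₁ ν₂ : Measure X} [IsFiniteMeasure ν₁] [SigmaFinite ν₂]

/-- A bounded density with respect to a finite measure makes `ν₂` finite. -/
lemma isFiniteMeasure_of_memLp_density (hac : ν₂ ≪ ν₁) (hμ : MemLp (density ν₁ ν₂) ⊤ ν₁) :
    IsFiniteMeasure ν₂ := by
  have hint : Integrable (density ν₁ ν₂) ν₁ := hμ.integrable le_top
  refine ⟨?_⟩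
  rw [← Measure.lintegral_rnDeriv hac]
  refine lt_of_le_of_lt (le_of_eq (lintegral_congr_ae ?_)) hint.lintegral_lt_top
  filter_upwards [Measure.rnDeriv_lt_top ν₂ ν₁] with x hx
  exact (ENNReal.ofReal_toReal hx.ne).symm

/-- In the pairing with a test function, the weight `μ = dν₂/dν₁` turns the `p`-Laplacian part into an
integral over `ν₂`. -/
lemma integral_operator_mul (hac : ν₂ ≪ ν₁) {v₁ w : Lp ℝ 2 ν₁} {v₂ : X → ℝ}
    (h : ∀ᵐ x ∂ν₁, w x = -v₁ x - density ν₁ ν₂ x * v₂ x) {ψ : X → ℝ} (hψ : MemLp ψ 2 ν₁) :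
    ∫ x, w x * ψ x ∂ν₁ = -∫ x, v₁ x * ψ x ∂ν₁ - ∫ x, v₂ x * ψ x ∂ν₂ := by
  have i1 : Integrable (fun x => v₁ x * ψ x) ν₁ := (Lp.memLp v₁).integrable_mul hψ
  have i2 : Integrable (fun x => w x * ψ x) ν₁ := (Lp.memLp w).integrable_mul hψ
  have e : ∫ x, v₂ x * ψ x ∂ν₂ = ∫ x, -(w x * ψ x) - v₁ x * ψ x ∂ν₁ := by
    rw [← integral_rnDeriv_smul hac]
    refine integral_congr_ae ?_
    filter_upwards [h] with x hx
    rw [hx, smul_eq_mul, density]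
    ring
  rw [e, integral_sub (f := fun x => -(w x * ψ x)) i2.neg i1, integral_neg]
  ring

lemma onePOperator_integral_mul_nonneg (hν₁ : m₁.Invariant ν₁) (hν₂ : m₂.IsReversible ν₂)
    (hac : ν₂ ≪ ν₁) (hμ : MemLp (density ν₁ ν₂) ⊤ ν₁) (hp : 1 < p) {x w : Lp ℝ 2 ν₁}
    (h : (x, w) ∈ onePOperator p m₁ m₂ ν₁ ν₂) {q : ℝ → ℝ} (hq : Monotone q) {K : NNReal}
    (hK : LipschitzWith K q) {C : ℝ} (hC : ∀ s, |q s| ≤ C) :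
    0 ≤ ∫ a, w a * q (x a) ∂ν₁ := by
  obtain ⟨v₁, v₂, hv₁, hv₂, hw⟩ := h
  have := isFiniteMeasure_of_memLp_density hac hμ
  have hx : Measurable x := (Lp.stronglyMeasurable x).measurable
  have hqx : MemLp (fun a => q (x a)) 2 ν₁ :=
    MemLp.of_bound (hq.measurable.comp hx).aestronglyMeasurable C
      (Filter.Eventually.of_forall fun a => hC _)
  rw [integral_operator_mul hac hw hqx]
  have h1 := oneLaplacian_integral_mul_nonpos hν₁ hv₁ hq hK hqx
  have h2 := integral_pLaplacian_mul_monotone_nonpos hν₂ hp hx hv₂ hq hC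
  linarith

lemma totalVariation_le_inner_onePOperator (hν₁ : m₁.Invariant ν₁) (hν₂ : m₂.IsReversible ν₂)
    (hac : ν₂ ≪ ν₁) (hμ : MemLp (density ν₁ ν₂) ⊤ ν₁) (hp : 1 < p) {x w : Lp ℝ 2 ν₁}
    (h : (x, w) ∈ onePOperator p m₁ m₂ ν₁ ν₂) :
    totalVariation m₁ ν₁ x ≠ ⊤ ∧ (totalVariation m₁ ν₁ x).toReal ≤ inner ℝ x w := by
  obtain ⟨v₁, v₂, hv₁, hv₂, hw⟩ := h
  have := isFiniteMeasure_of_memLp_density hac hμ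
  obtain ⟨htop, hle⟩ := totalVariation_le_neg_inner hν₁ hv₁
  refine ⟨htop, hle.trans ?_⟩
  rw [inner_eq_integral_mul, integral_operator_mul hac hw (Lp.memLp x)]
  have h2 := integral_pLaplacian_mul_self_nonpos hν₂ hp
    (Lp.stronglyMeasurable x).measurable hv₂
  linarith

end Operator

/-! ### A regularization of the absolute value -/

/-- The regularized sign `s ↦ max (-1) (min 1 (s / ε))`. -/
noncomputable def clip (ε s : ℝ) : ℝ := max (-1) (min 1 (s / ε))

/-- The Huber function: the convex primitive of `clip ε` vanishing at `0`, equal to `s² / (2ε)` for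
`|s| ≤ ε` and to `|s| - ε / 2` otherwise. It is written through the maximizer `θ = clip ε s` of
`θ s - ε θ² / 2` over `|θ| ≤ 1`, from which convexity is immediate. -/
noncomputable def huber (ε s : ℝ) : ℝ := clip ε s * s - ε / 2 * clip ε s ^ 2

lemma clip_mem (ε s : ℝ) : -1 ≤ clip ε s ∧ clip ε s ≤ 1 :=
  ⟨le_max_left _ _, max_le (by norm_num) (min_le_left _ _)⟩

lemma abs_clip_le_one (ε s : ℝ) : |clip ε s| ≤ 1 := abs_le.2 (clip_mem ε s)

lemma clip_zero (ε : ℝ) : clip ε 0 = 0 := by simp [clip]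

lemma monotone_clip {ε : ℝ} (hε : 0 < ε) : Monotone (clip ε) := fun s t hst => by
  unfold clip
  gcongr

lemma lipschitzWith_clip (ε : ℝ) : LipschitzWith ‖ε⁻¹‖₊ (clip ε) := by
  have h : LipschitzWith ‖ε⁻¹‖₊ fun s : ℝ => s / ε := by
    refine LipschitzWith.of_dist_le_mul fun s t => le_of_eq ?_
    rw [Real.dist_eq, Real.dist_eq, ← sub_div, div_eq_inv_mul, abs_mul, coe_nnnorm,
      Real.norm_eq_abs]
  exact (h.const_min 1).const_max (-1)

lemma mul_sub_sq_le_huber {ε : ℝ} (hε : 0 < ε) {θ : ℝ} (hθ : -1 ≤ θ ∧ θ ≤ 1) (s : ℝ) :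
    θ * s - ε / 2 * θ ^ 2 ≤ huber ε s := by
  have hs : ε * (s / ε) = s := mul_div_cancel₀ s hε.ne'
  generalize hr : s / ε = r at hs
  -- The difference is `ε / 2 * ((r - θ) ^ 2 - (r - clip) ^ 2)`, and `clip` is the projection
  -- of `r` onto `[-1, 1]`.
  have key : 0 ≤ (clip ε s - θ) * (2 * r - clip ε s - θ) := by
    unfold clip
    rw [hr]
    rcases le_total r 1 with h1 | h1
    · rw [min_eq_right h1]
      rcases le_total (-1) r with h2 | h2
      · rw [max_eq_right h2]
        nlinarith [sq_nonneg (r - θ)]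
      · rw [max_eq_left h2]
        nlinarith
    · rw [min_eq_left h1, max_eq_right (by norm_num)]
      nlinarith
  have h2 := mul_nonneg (half_pos hε).le key
  rw [huber, ← hs] at *
  nlinarith

lemma huber_sub_le {ε : ℝ} (hε : 0 < ε) (s t : ℝ) :
    huber ε s - huber ε t ≤ clip ε s * (s - t) := by
  have := mul_sub_sq_le_huber hε (clip_mem ε s) t
  rw [huber]
  linarith

lemma huber_le_abs {ε : ℝ} (hε : 0 < ε) (s : ℝ) : huber ε s ≤ |s| := by
  have h1 : clip ε s * s ≤ |s| := (le_abs_self _).trans (by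
    rw [abs_mul]
    exact mul_le_of_le_one_left (abs_nonneg s) (abs_clip_le_one ε s))
  have h2 : 0 ≤ ε / 2 * clip ε s ^ 2 := by positivity
  rw [huber]
  linarith

lemma huber_nonneg {ε : ℝ} (hε : 0 < ε) (s : ℝ) : 0 ≤ huber ε s := by
  simpa using mul_sub_sq_le_huber hε (θ := 0) (by norm_num) s

lemma abs_sub_half_le_huber {ε : ℝ} (hε : 0 < ε) (s : ℝ) : |s| - ε / 2 ≤ huber ε s := by
  rcases le_total 0 s with h | h
  · rw [abs_of_nonneg h]
    simpa using mul_sub_sq_le_huber hε (θ := 1) (by norm_num) s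
  · rw [abs_of_nonpos h]
    simpa using mul_sub_sq_le_huber hε (θ := -1) (by norm_num) s

lemma continuous_huber (ε : ℝ) : Continuous (huber ε) := by
  have := (lipschitzWith_clip ε).continuous
  unfold huber
  fun_prop

/-! ### Conservation of mass and decay of the `L¹` distance to a constant -/

section Decay

variable {p : ℝ} {m₁ m₂ : Kernel X X} [IsMarkovKernel m₁] [IsMarkovKernel m₂]
  {ν₁ ν₂ : Measure X} [IsFiniteMeasure ν₁] [SigmaFinite ν₂]

/-- The linear functionals `f ↦ k ∫ f` with `k = 1` and `k = -1` are both nonincreasing along `u`. -/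
lemma integral_strongSolution_eq (hν₁ : m₁.Invariant ν₁) (hν₂ : m₂.IsReversible ν₂)
    (hac : ν₂ ≪ ν₁) (hμ : MemLp (density ν₁ ν₂) ⊤ ν₁) (hp : 1 < p) {u₀ : Lp ℝ 2 ν₁} {T : ℝ}
    {u : ℝ → Lp ℝ 2 ν₁} (hu : IsStrongSolution (onePOperator p m₁ m₂ ν₁ ν₂) T u₀ u) {t : ℝ}
    (ht : 0 ≤ t) (htT : t ≤ T) : ∫ x, u t x ∂ν₁ = ∫ x, u₀ x ∂ν₁ := by
  have hin : ∀ (k : ℝ) (f : Lp ℝ 2 ν₁), inner ℝ (Lp.const 2 ν₁ k) f = (∫ x, f x ∂ν₁) * k := by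
    intro k f
    rw [inner_eq_integral_mul, ← integral_mul_const]
    refine integral_congr_ae ?_
    filter_upwards [Lp.coeFn_const 2 ν₁ k] with x hx
    rw [hx, Function.const_apply]
  have key : ∀ k : ℝ, (∫ x, u t x ∂ν₁) * k ≤ (∫ x, u₀ x ∂ν₁) * k := by
    intro k
    have := hu.energy_le (φ := fun f => inner ℝ (Lp.const 2 ν₁ k) f)
      (Q := fun _ => Lp.const 2 ν₁ k) continuous_const (fun x y => (inner_sub_right _ _ _).ge)
      (B := 0) le_rfl ht htT fun s _ w hw => by
        rw [hin, ← integral_mul_const]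
        exact onePOperator_integral_mul_nonneg hν₁ hν₂ hac hμ hp hw
          (q := fun _ => k) monotone_const (LipschitzWith.const k) (C := |k|) fun _ => le_rfl
    simpa [hin, hu.initial] using this
  have h1 := key 1
  have h2 := key (-1)
  linarith

/-- The Huber energies `∫ huber ε (u - c)` decrease, and they differ from the `L¹` distance by at most
`ε ν₁(X) / 2`. -/
lemma integral_abs_sub_strongSolution_le (hν₁ : m₁.Invariant ν₁) (hν₂ : m₂.IsReversible ν₂)
    (hac : ν₂ ≪ ν₁) (hμ : MemLp (density ν₁ ν₂) ⊤ ν₁) (hp : 1 < p) {u₀ : Lp ℝ 2 ν₁} {T : ℝ}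
    {u : ℝ → Lp ℝ 2 ν₁} (hu : IsStrongSolution (onePOperator p m₁ m₂ ν₁ ν₂) T u₀ u) (c : ℝ)
    {s t : ℝ} (hs : 0 ≤ s) (hst : s ≤ t) (htT : t ≤ T) :
    ∫ x, |u t x - c| ∂ν₁ ≤ ∫ x, |u s x - c| ∂ν₁ := by
  have habs : ∀ f : Lp ℝ 2 ν₁, Integrable (fun x => |f x - c|) ν₁ := fun f =>
    (((Lp.memLp f).integrable one_le_two).sub (integrable_const c)).abs
  have hhub : ∀ ε > 0, ∀ f : Lp ℝ 2 ν₁, Integrable (fun x => huber ε (f x - c)) ν₁ :=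
    fun ε hε f => (habs f).mono'
      ((continuous_huber ε).measurable.comp
        ((Lp.stronglyMeasurable f).measurable.sub_const c)).aestronglyMeasurable
      (Filter.Eventually.of_forall fun x => by
        rw [Real.norm_eq_abs, abs_of_nonneg (huber_nonneg hε _)]
        exact huber_le_abs hε _)
  have main : ∀ ε > 0, ∫ x, |u t x - c| ∂ν₁ - ε / 2 * ν₁.real univ ≤ ∫ x, |u s x - c| ∂ν₁ := by
    intro ε hε
    set Q : Lp ℝ 2 ν₁ → Lp ℝ 2 ν₁ := fun f =>
      (lipschitzWith_clip ε).compLp (clip_zero ε) (f - Lp.const 2 ν₁ c) with hQ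
    have hQc : Continuous Q :=
      ((lipschitzWith_clip ε).continuous_compLp (clip_zero ε)).comp (by fun_prop)
    have hQx : ∀ f, Q f =ᵐ[ν₁] fun x => clip ε (f x - c) := by
      intro f
      filter_upwards [(lipschitzWith_clip ε).coeFn_compLp (clip_zero ε) (f - Lp.const 2 ν₁ c),
        Lp.coeFn_sub f (Lp.const 2 ν₁ c), Lp.coeFn_const 2 ν₁ c] with x h1 h2 h3
      rw [h1, Function.comp_apply, h2, Pi.sub_apply, h3, Function.const_apply]
    have hdec := hu.energy_le (φ := fun f => ∫ x, huber ε (f x - c) ∂ν₁) hQc ?_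
      (B := 0) hs hst htT fun r _ w hw => ?_
    · rw [zero_mul, add_zero] at hdec
      calc ∫ x, |u t x - c| ∂ν₁ - ε / 2 * ν₁.real univ
          = ∫ x, (|u t x - c| - ε / 2) ∂ν₁ := by
            rw [integral_sub (habs _) (integrable_const _), integral_const, smul_eq_mul, mul_comm]
        _ ≤ ∫ x, huber ε (u t x - c) ∂ν₁ :=
            integral_mono ((habs _).sub (integrable_const _)) (hhub ε hε _)
              fun x => abs_sub_half_le_huber hε _
        _ ≤ ∫ x, huber ε (u s x - c) ∂ν₁ := hdec
        _ ≤ ∫ x, |u s x - c| ∂ν₁ :=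
            integral_mono (hhub ε hε _) (habs _) fun x => huber_le_abs hε _
    · intro f g
      rw [← integral_sub (hhub ε hε f) (hhub ε hε g), inner_eq_integral_mul]
      refine integral_mono_ae ((hhub ε hε f).sub (hhub ε hε g))
        ((Lp.memLp (f - g)).integrable_mul (Lp.memLp (Q f))) ?_
      filter_upwards [hQx f, Lp.coeFn_sub f g] with x h1 h2
      rw [h1, h2, Pi.sub_apply, mul_comm]
      simpa using huber_sub_le hε (f x - c) (g x - c)
    · rw [inner_eq_integral_mul]
      refine (onePOperator_integral_mul_nonneg hν₁ hν₂ hac hμ hp hw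
        (q := fun a => clip ε (a - c)) (K := ‖ε⁻¹‖₊) (C := 1)
        (fun a b hab => monotone_clip hε (by linarith)) ?_
        fun a => abs_clip_le_one ε _).trans (le_of_eq (integral_congr_ae ?_))
      · refine LipschitzWith.of_dist_le_mul fun a b => ?_
        simpa using (lipschitzWith_clip ε).dist_le_mul (a - c) (b - c)
      · filter_upwards [hQx (u r)] with x h1
        rw [h1]
  refine le_of_forall_pos_le_add fun η hη => ?_
  have h0 : 0 ≤ ν₁.real univ := measureReal_nonneg
  have h1 := main (2 * η / (ν₁.real univ + 1)) (by positivity)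
  have h2 : 2 * η / (ν₁.real univ + 1) / 2 * ν₁.real univ ≤ η := by
    rw [mul_div_assoc, mul_div_cancel_left₀ _ two_ne_zero, div_mul_eq_mul_div,
      div_le_iff₀ (by positivity)]
    nlinarith
  linarith

end Decay

end RandomWalk

theorem theorem3p4 {X : Type*} [MeasurableSpace X] [MeasurableSpace.CountablyGenerated X]
    (m₁ m₂ : Kernel X X) [IsMarkovKernel m₁] [IsMarkovKernel m₂]
    (ν₁ ν₂ : Measure X) [IsFiniteMeasure ν₁] [SigmaFinite ν₂]
    (hν₁ : m₁.Invariant ν₁) (hν₂ : m₂.IsReversible ν₂)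
    (hac : ν₂ ≪ ν₁) (hμ : MemLp (RandomWalk.density ν₁ ν₂) ⊤ ν₁)
    (hμc : ∃ c : ℝ, 0 < c ∧ ∀ᵐ x ∂ν₁, c ≤ RandomWalk.density ν₁ ν₂ x)
    (p : ℝ) (hp : 1 < p)
    (lam : ℝ) (hlam : 0 < lam) (hPoincare : RandomWalk.PoincareInequality 1 m₁ ν₁ lam)
    (u₀ : Lp ℝ 2 ν₁) (T : ℝ) (u : ℝ → Lp ℝ 2 ν₁)
    (hu : RandomWalk.IsStrongSolution (RandomWalk.onePOperator p m₁ m₂ ν₁ ν₂) T u₀ u) :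
    ∀ t : ℝ, 0 < t → t ≤ T →
      eLpNorm (fun x => u t x - ⨍ y, u₀ y ∂ν₁) 1 ν₁
        ≤ ENNReal.ofReal (1 / (2 * lam) * (‖u₀‖ ^ 2 / t)) := by
  intro t ht htT
  set c : ℝ := ⨍ y, u₀ y ∂ν₁ with hc
  have hnorm : ∀ s, eLpNorm (fun x => u s x - c) 1 ν₁
      = ENNReal.ofReal (∫ x, |u s x - c| ∂ν₁) := by
    intro s
    have hi : Integrable (fun x => u s x - c) ν₁ :=
      ((Lp.memLp (u s)).integrable one_le_two).sub (integrable_const c)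
    rw [eLpNorm_one_eq_lintegral_enorm]
    exact (ofReal_integral_norm_eq_lintegral_enorm hi).symm
  set N : ℝ := ∫ x, |u t x - c| ∂ν₁ with hN
  have hN0 : 0 ≤ N := integral_nonneg fun _ => abs_nonneg _
  -- On `(0, t)` the energy `‖u‖² / 2` dissipates at rate at least `lam * N`, because `N` is the
  -- smallest `L¹` distance to `c` up to time `t`.
  have henergy := hu.energy_le (φ := fun f => ‖f‖ ^ 2 / 2) (Q := id) continuous_id
    (fun x y => by
      simp only [id]
      rw [inner_sub_right, real_inner_self_eq_norm_sq]
      linarith [norm_sub_sq_real x y, sq_nonneg ‖x - y‖])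
    (B := lam * N) le_rfl ht.le htT fun s hs w hw => by
      have havg : ⨍ y, u s y ∂ν₁ = c := by
        rw [hc, average_eq, average_eq, RandomWalk.integral_strongSolution_eq hν₁ hν₂ hac hμ hp hu
          hs.1.le (hs.2.le.trans htT)]
      obtain ⟨htop, hF⟩ :=
        RandomWalk.totalVariation_le_inner_onePOperator hν₁ hν₂ hac hμ hp hw
      have h1 := ENNReal.toReal_mono htop
        (RandomWalk.ofReal_mul_eLpNorm_sub_average_le_totalVariation hPoincare (u s))
      rw [havg, hnorm, ← ENNReal.ofReal_mul hlam.le, ENNReal.toReal_ofReal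
        (mul_nonneg hlam.le (integral_nonneg fun _ => abs_nonneg _))] at h1
      have h2 := RandomWalk.integral_abs_sub_strongSolution_le hν₁ hν₂ hac hμ hp hu c
        hs.1.le hs.2.le htT
      have h3 : lam * N ≤ lam * ∫ x, |u s x - c| ∂ν₁ := mul_le_mul_of_nonneg_left h2 hlam.le
      simp only [id]
      linarith
  rw [hu.initial] at henergy
  rw [hnorm]
  refine ENNReal.ofReal_le_ofReal ?_
  rw [← hN, div_mul_div_comm, one_mul, le_div_iff₀ (by positivity)]
  have : 0 ≤ ‖u t‖ ^ 2 := sq_nonneg _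
  linarith
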